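/- Let $F$ be the free group on $x_1,x_2,x_3,x_4$, with the indices read modulo $4$. Let $$G=\langle F,t \mid t^4=1,\ t^{-1}x_it=x_{i+1}\ (i\in\mathbb Z/4)\rangle ,$$ and let $H_1=\langle x_1,x_2\rangle\le G$. Then $\mathrm{WeakWidth}(H_1,G)=3$, while $\mathrm{Height}(H_1,G)=\mathrm{Width}(H_1,G)=2$. In particular, the weak width of $H_1$ in $G$ differs from both its height and its width. Here, for a subgroup $H$ of a group $G$, elements $g_1,\dots,g_n\in G$ are called $H$-essentially distinct if $Hg_i\ne Hg_j$ for $i\neq j$, and strongly $H$-essentially distinct if $Hg_iH\neq Hg_jH$ for $i\ne j$. If $H$ is infinite: - $\mathrm{Height}(H,G)$ is the maximal $n$ for which there are $H$-essentially distinct $g_1,\dots,g_n\in G$ with $\bigcap_{i=1}^n g_i^{-1}Hg_i$ infinite; - $\mathrm{Width}(H,G)$ is the maximal $n$ for which there are $H$-essentially distinct $g_1,\dots,g_n\in G$ with $g_i^{-1}Hg_i\cap g_j^{-1}Hg_j$ infinite for all $i\neq j$; - $\mathrm{WeakWidth}(H,G)$ is the maximal $n\ge 1$ for which there are strongly $H$-essentially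 distinct $g_0=1,g_1,\dots,g_{n-1}\in G$ with $H\cap g_i^{-1}Hg_i$ infinite for all $1\le i\le n-1$. Each of these is $\infty$ if there is no maximal $n$, and all three are defined to be $0$ if $H$ is finite. -/

import Mathlib

namespace SubgroupWidth

variable {G : Type*} [Group G]

/-- The conjugate `g⁻¹ H g`. -/
def conjugate (H : Subgroup G) (g : G) : Subgroup G :=
  H.map (MulAut.conj g⁻¹).toMonoidHom

/-- The elements `g i` are `H`-essentially distinct: the right cosets `H (g i)` are pairwise
different. -/
def EssentiallyDistinct (H : Subgroup G) {n : ℕ} (g : Fin n → G) : Prop :=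
  ∀ i j, i ≠ j → (fun h => h * g i) '' (H : Set G) ≠ (fun h => h * g j) '' (H : Set G)

/-- The elements `g i` are strongly `H`-essentially distinct: the double cosets `H (g i) H` are
pairwise different. -/
def StronglyEssentiallyDistinct (H : Subgroup G) {n : ℕ} (g : Fin n → G) : Prop :=
  ∀ i j, i ≠ j →
    DoubleCoset.doubleCoset (g i) (H : Set G) (H : Set G) ≠
      DoubleCoset.doubleCoset (g j) (H : Set G) (H : Set G)

/-- There are `n` essentially distinct conjugates of `H` whose common intersection is infinite. -/
def HeightWitness (H : Subgroup G) (n : ℕ) : Prop :=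
  ∃ g : Fin n → G, EssentiallyDistinct H g ∧
    ((⨅ i, conjugate H (g i) : Subgroup G) : Set G).Infinite

/-- There are `n` essentially distinct conjugates of `H` such that the intersection of any two
of them is infinite. -/
def WidthWitness (H : Subgroup G) (n : ℕ) : Prop :=
  ∃ g : Fin n → G, EssentiallyDistinct H g ∧
    ∀ i j, i ≠ j → ((conjugate H (g i) ⊓ conjugate H (g j) : Subgroup G) : Set G).Infinite

/-- There are `n ≥ 1` strongly essentially distinct conjugates of `H`, the first of which is `H`
itself (the conjugate by `1`), such that each of the others has infinite intersection with `H`. -/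
def WeakWidthWitness (H : Subgroup G) (n : ℕ) : Prop :=
  ∃ m : ℕ, n = m + 1 ∧ ∃ g : Fin (m + 1) → G, g 0 = 1 ∧ StronglyEssentiallyDistinct H g ∧
    ∀ i, i ≠ 0 → ((H ⊓ conjugate H (g i) : Subgroup G) : Set G).Infinite

open Classical in
/-- The height of `H` in `G`: the maximal size of a collection as in `HeightWitness` (`⊤` if the
sizes are unbounded), and `0` if `H` is finite. -/
noncomputable def height (H : Subgroup G) : ℕ∞ :=
  if (H : Set G).Infinite then ⨆ n ∈ {n : ℕ | HeightWitness H n}, (n : ℕ∞) else 0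

open Classical in
/-- The width of `H` in `G`: the maximal size of a collection as in `WidthWitness` (`⊤` if the
sizes are unbounded), and `0` if `H` is finite. -/
noncomputable def width (H : Subgroup G) : ℕ∞ :=
  if (H : Set G).Infinite then ⨆ n ∈ {n : ℕ | WidthWitness H n}, (n : ℕ∞) else 0

open Classical in
/-- The weak width of `H` in `G`: the maximal size of a collection as in `WeakWidthWitness` (`⊤`
if the sizes are unbounded), and `0` if `H` is finite. -/
noncomputable def weakWidth (H : Subgroup G) : ℕ∞ :=
  if (H : Set G).Infinite then ⨆ n ∈ {n : ℕ | WeakWidthWitness H n}, (n : ℕ∞) else 0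

end SubgroupWidth

namespace WidthExample

/-- The generators `x i`, with indices modulo `4`, and `t`. -/
inductive Gen : Type
  | x (i : ZMod 4)
  | t

/-- The relators of `t ^ 4 = 1` and `t⁻¹ (x i) t = x (i + 1)`. -/
def relators : Set (FreeGroup Gen) :=
  {FreeGroup.of Gen.t ^ 4} ∪
    Set.range fun i : ZMod 4 =>
      (FreeGroup.of Gen.t)⁻¹ * FreeGroup.of (Gen.x i) * FreeGroup.of Gen.t *
        (FreeGroup.of (Gen.x (i + 1)))⁻¹

/-- The group `⟨x₁, x₂, x₃, x₄, t ∣ t⁴ = 1, t⁻¹ xᵢ t = xᵢ₊₁⟩`. -/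
abbrev ExampleGroup : Type := PresentedGroup relators

/-- The subgroup `⟨x₁, x₂⟩`. -/
def H₁ : Subgroup ExampleGroup :=
  Subgroup.closure {PresentedGroup.of (Gen.x 1), PresentedGroup.of (Gen.x 2)}

end WidthExample

/-! The group is $F\rtimes\mathbb Z/4$, so every $g$ is $t^kf$ with $f\in F$. If $H_1\cap
g^{-1}H_1g$ is nontrivial, then $f$ conjugates a nontrivial element of $\langle x_1,x_2\rangle$ into
$\langle x_{1+k},x_{2+k}\rangle$. Free factors on disjoint sets of letters share no nontrivial
conjugacy class, so $k\ne 2$. Otherwise $f=vw$ with $v$ and $w$ in these two factors, and moving $v$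
past $t^k$ gives $g\in H_1t^kH_1$ (`exists_eq_mul_t_pow_mul`).

Hence only the double cosets of $1,t,t^{-1}$ can occur. The last two do occur, through $x_2$ and
$x_1$, and the exponent of $t$ separates all three: the weak width is 3. For the width, all pairs
count: $g_ig_j^{-1}$ must lie in $H_1t^{\pm1}H_1$, so the $t$-exponents of the $g_i$ pairwise differ
by odd numbers, which allows only two of them. Height is at most width, and $1,t$ attain 2 for both.
-/

namespace FreeGroup

/-! ### Conjugacy between free factors of a free group -/

variable {α : Type*}

/-- Elements of the subgroup generated by a set of letters are spelled with these letters. -/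
theorem fst_mem_of_mem_closure [DecidableEq α] {B : Set α} {w : FreeGroup α}
    (hw : w ∈ Subgroup.closure (FreeGroup.of '' B)) : ∀ l ∈ w.toWord, l.1 ∈ B := by
  induction hw using Subgroup.closure_induction with
  | mem x hx =>
    obtain ⟨b, hb, rfl⟩ := hx
    simpa using hb
  | one => simp
  | mul x y _ _ hx hy =>
    intro l hl
    rcases List.mem_append.1 ((toWord_mul_sublist x y).subset hl) with h | h
    exacts [hx l h, hy l h]
  | inv x _ hx =>
    intro l hl
    rw [toWord_inv] at hl
    simp only [invRev, List.mem_reverse, List.mem_map] at hl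
    obtain ⟨m, hm, rfl⟩ := hl
    exact hx m hm

theorem mk_singleton_mem_closure {B : Set α} {l : α × Bool} (hl : l.1 ∈ B) :
    FreeGroup.mk [l] ∈ Subgroup.closure (FreeGroup.of '' B) := by
  have h : FreeGroup.of l.1 ∈ Subgroup.closure (FreeGroup.of '' B) :=
    Subgroup.subset_closure ⟨_, hl, rfl⟩
  obtain ⟨x, _ | _⟩ := l
  · have := inv_mem h
    simpa [FreeGroup.of, invRev] using this
  · exact h

/-- If `L` is reduced with first letter outside `B` and last letter outside `A`, no nontrivial
element spelled in `B` is conjugated by `L` to one spelled in `A`. -/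
theorem eq_one_of_mul_eq_mul [DecidableEq α] {A B : Set α} {a b u : FreeGroup α}
    (ha : ∀ l ∈ a.toWord, l.1 ∈ A) (hb : ∀ l ∈ b.toWord, l.1 ∈ B)
    (hB : ∀ l ∈ u.toWord.head?, l.1 ∉ B) (hA : ∀ l ∈ u.toWord.getLast?, l.1 ∉ A)
    (hu : u ≠ 1) (h : b * u = u * a) : b = 1 := by
  have hbu : IsReduced (b.toWord ++ u.toWord) := by
    refine List.isChain_append.2 ⟨isReduced_toWord, isReduced_toWord, ?_⟩
    intro x hx y hy hxy
    exact absurd (hxy ▸ hb x (List.mem_of_mem_getLast? hx)) (hB y hy)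
  have hua : IsReduced (u.toWord ++ a.toWord) := by
    refine List.isChain_append.2 ⟨isReduced_toWord, isReduced_toWord, ?_⟩
    intro x hx y hy hxy
    exact absurd (hxy ▸ ha y (List.mem_of_mem_head? hy)) (hA x hx)
  -- No cancellation occurs on either side, so the words agree letter by letter; their first letter
  -- would lie both in `B` and outside it.
  have hw : b.toWord ++ u.toWord = u.toWord ++ a.toWord := by
    rw [← hbu.reduce_eq, ← hua.reduce_eq, ← toWord_mul, ← toWord_mul, h]
  by_contra hb1
  obtain ⟨l, L, hL⟩ := List.exists_cons_of_ne_nil (mt toWord_eq_nil_iff.1 hb1)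
  obtain ⟨m, M, hM⟩ := List.exists_cons_of_ne_nil (mt toWord_eq_nil_iff.1 hu)
  rw [hL, hM, List.cons_append, List.cons_append] at hw
  obtain ⟨rfl, -⟩ := List.cons.inj hw
  exact hB l (by simp [hM]) (hb l (by simp [hL]))

/-- A conjugator between nontrivial elements of the free factors on `B` and on `A` is a product
of elements of these factors. -/
theorem exists_eq_mul_of_mul_eq_mul [DecidableEq α] {A B : Set α} {a b : FreeGroup α}
    (u : FreeGroup α)
    (ha : a ∈ Subgroup.closure (FreeGroup.of '' A))
    (hb : b ∈ Subgroup.closure (FreeGroup.of '' B)) (hb1 : b ≠ 1) (h : b * u = u * a) :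
    ∃ v ∈ Subgroup.closure (FreeGroup.of '' B), ∃ w ∈ Subgroup.closure (FreeGroup.of '' A),
      u = v * w := by
  induction hn : u.toWord.length using Nat.strong_induction_on generalizing a b u with
  | _ n ih =>
    subst hn
    by_cases hu : u = 1
    · exact ⟨1, one_mem _, 1, one_mem _, by simp [hu]⟩
    by_cases hB : ∀ l ∈ u.toWord.head?, l.1 ∉ B
    · by_cases hA : ∀ l ∈ u.toWord.getLast?, l.1 ∉ A
      · exact absurd (eq_one_of_mul_eq_mul (fst_mem_of_mem_closure ha)
          (fst_mem_of_mem_closure hb) hB hA hu h) hb1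
      · push Not at hA
        -- A last letter `c` of `u` from `A` is absorbed into `a`: with `u = L * c`, the relation
        -- becomes `b * L = L * (c * a * c⁻¹)`, with a shorter conjugator. A first letter from `B`
        -- is absorbed into `b` likewise.
        obtain ⟨l, hl, hlA⟩ := hA
        have hc := mk_singleton_mem_closure hlA
        set c := FreeGroup.mk [l]
        obtain ⟨L, hL⟩ : ∃ L, u.toWord = L ++ [l] :=
          ⟨_, (List.dropLast_append_getLast? l hl).symm⟩
        have huL : u = FreeGroup.mk L * c := by
          rw [← mk_toWord (x := u), hL, ← mul_mk]
        have hlen : (FreeGroup.mk L).toWord.length < u.toWord.length := by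
          have : (FreeGroup.mk L).toWord.length ≤ L.length := norm_mk_le
          rw [hL, List.length_append]
          simp only [List.length_singleton]
          omega
        obtain ⟨v, hv, w, hw, e⟩ := ih _ hlen (a := c * a * c⁻¹) (b := b) (FreeGroup.mk L)
          (mul_mem (mul_mem hc ha) (inv_mem hc)) hb hb1
          (by rw [huL] at h; rw [← mul_assoc, ← mul_assoc, ← h]; group) rfl
        exact ⟨v, hv, w * c, mul_mem hw hc, by rw [huL, e, mul_assoc]⟩
    · push Not at hB
      obtain ⟨l, hl, hlB⟩ := hB
      have hc := mk_singleton_mem_closure hlB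
      set c := FreeGroup.mk [l]
      obtain ⟨L, hL⟩ : ∃ L, u.toWord = l :: L :=
        ⟨_, (List.cons_head?_tail hl).symm⟩
      have huL : u = c * FreeGroup.mk L := by
        rw [← mk_toWord (x := u), hL, mul_mk, List.singleton_append]
      have hlen : (FreeGroup.mk L).toWord.length < u.toWord.length := by
        have : (FreeGroup.mk L).toWord.length ≤ L.length := norm_mk_le
        rw [hL, List.length_cons]
        omega
      obtain ⟨v, hv, w, hw, e⟩ := ih _ hlen (a := a) (b := c⁻¹ * b * c) (FreeGroup.mk L) ha
        (mul_mem (mul_mem (inv_mem hc) hb) hc)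
        (by simpa [mul_assoc, inv_mul_eq_one, eq_comm] using hb1)
        (by rw [huL] at h; rw [mul_assoc, mul_assoc, h]; group) rfl
      exact ⟨c * v, mul_mem hc hv, w, hw, by rw [huL, e, mul_assoc]⟩

/-- Nontrivial elements of free factors on disjoint sets of letters are not conjugate. -/
theorem inter_nonempty_of_mul_eq_mul {A B : Set α} {a b u : FreeGroup α}
    (ha : a ∈ Subgroup.closure (FreeGroup.of '' A))
    (hb : b ∈ Subgroup.closure (FreeGroup.of '' B)) (hb1 : b ≠ 1) (h : b * u = u * a) :
    (A ∩ B).Nonempty := by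
  classical
  by_contra hAB
  -- The retraction onto the factor on `B` kills `a` and fixes `b`.
  let r : FreeGroup α →* FreeGroup α :=
    FreeGroup.lift fun x => if x ∈ B then FreeGroup.of x else 1
  have hrA : Subgroup.closure (FreeGroup.of '' A) ≤ r.ker := by
    rw [Subgroup.closure_le]
    rintro _ ⟨x, hx, rfl⟩
    have : x ∉ B := fun hxB => hAB ⟨x, hx, hxB⟩
    simp [r, MonoidHom.mem_ker, this]
  have hrB : Subgroup.closure (FreeGroup.of '' B) ≤ r.eqLocus (MonoidHom.id _) := by
    rw [Subgroup.closure_le]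
    rintro _ ⟨x, hx, rfl⟩
    change r (FreeGroup.of x) = FreeGroup.of x
    simp [r, hx]
  have h1 : r a = 1 := hrA ha
  have h2 : r b = b := hrB hb
  have h3 := congrArg r h
  rw [_root_.map_mul, _root_.map_mul, h1, h2, mul_one] at h3
  exact hb1 (by simpa using h3)

end FreeGroup

/-! ### Conjugates and essentially distinct elements -/

namespace SubgroupWidth

variable {G : Type*} [Group G] {H : Subgroup G}

theorem mem_conjugate {g h : G} : h ∈ conjugate H g ↔ g * h * g⁻¹ ∈ H := by
  unfold conjugate
  rw [Subgroup.mem_map]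
  constructor
  · rintro ⟨x, hx, rfl⟩
    simpa [mul_assoc] using hx
  · exact fun hh => ⟨_, hh, by simp [mul_assoc]⟩

theorem conjugate_one : conjugate H 1 = H := by
  ext h
  simp [mem_conjugate]

theorem EssentiallyDistinct.mul_inv_notMem {n : ℕ} {g : Fin n → G} (hg : EssentiallyDistinct H g)
    {i j : Fin n} (hij : i ≠ j) : g i * (g j)⁻¹ ∉ H := by
  intro h
  apply hg i j hij
  ext x
  simp only [Set.mem_image, SetLike.mem_coe]
  constructor
  · rintro ⟨y, hy, rfl⟩
    exact ⟨y * (g i * (g j)⁻¹), mul_mem hy h, by group⟩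
  · rintro ⟨y, hy, rfl⟩
    exact ⟨y * (g i * (g j)⁻¹)⁻¹, mul_mem hy (inv_mem h), by group⟩

theorem essentiallyDistinct_of_mul_inv_notMem {n : ℕ} {g : Fin n → G}
    (hg : ∀ i j, i ≠ j → g i * (g j)⁻¹ ∉ H) : EssentiallyDistinct H g := by
  intro i j hij h
  have : g i ∈ (fun h => h * g j) '' (H : Set G) := h ▸ ⟨1, one_mem _, one_mul _⟩
  obtain ⟨y, hy, hyi⟩ := this
  exact hg i j hij (by simpa [← hyi] using hy)

theorem HeightWitness.widthWitness {n : ℕ} (h : HeightWitness H n) : WidthWitness H n := by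
  obtain ⟨g, hg, hinf⟩ := h
  refine ⟨g, hg, fun i j _ => hinf.mono ?_⟩
  exact SetLike.coe_subset_coe.2 (le_inf (iInf_le _ i) (iInf_le _ j))

end SubgroupWidth

/-! ### The example group as a semidirect product -/

namespace WidthExample

open SubgroupWidth

/-- The generator `x i` of the example group. -/
def x (i : ZMod 4) : ExampleGroup := PresentedGroup.of (Gen.x i)

/-- The generator `t` of the example group. -/
def t : ExampleGroup := PresentedGroup.of Gen.t

theorem t_pow_four : t ^ 4 = 1 :=
  PresentedGroup.one_of_mem (rels := relators) (Or.inl rfl)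

theorem t_inv_mul_x_mul_t (i : ZMod 4) : t⁻¹ * x i * t = x (i + 1) := by
  have : t⁻¹ * x i * t * (x (i + 1))⁻¹ = 1 :=
    PresentedGroup.one_of_mem (rels := relators) (Or.inr ⟨i, rfl⟩)
  exact mul_inv_eq_one.1 this

/-- The homomorphism out of the example group given by values satisfying the relations. -/
noncomputable def homOfRelations {K : Type*} [Group K] (y : ZMod 4 → K) (s : K) (hs : s ^ 4 = 1)
    (hy : ∀ i, s⁻¹ * y i * s = y (i + 1)) : ExampleGroup →* K :=
  PresentedGroup.toGroup (f := fun a => Gen.rec y s a) (by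
    rintro r (rfl | ⟨i, rfl⟩)
    · simpa using hs
    · simpa [mul_inv_eq_one] using hy i)

section homOfRelations

variable {K : Type*} [Group K] (y : ZMod 4 → K) (s : K) (hs : s ^ 4 = 1)
    (hy : ∀ i, s⁻¹ * y i * s = y (i + 1))

@[simp]
theorem homOfRelations_x (i : ZMod 4) : homOfRelations y s hs hy (x i) = y i := by
  simp [homOfRelations, x]

@[simp]
theorem homOfRelations_t : homOfRelations y s hs hy t = s := by
  simp [homOfRelations, t]

end homOfRelations

/-- Translation of the indices of the generators of the free group. -/
def shift (k : ZMod 4) : FreeGroup (ZMod 4) →* FreeGroup (ZMod 4) :=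
  FreeGroup.map (· + k)

@[simp]
theorem shift_of (k i : ZMod 4) : shift k (FreeGroup.of i) = FreeGroup.of (i + k) := by
  simp [shift]

theorem shift_shift (k l : ZMod 4) (f : FreeGroup (ZMod 4)) :
    shift k (shift l f) = shift (l + k) f := by
  have : (shift k).comp (shift l) = shift (l + k) := by
    ext i
    simp [add_assoc]
  exact DFunLike.congr_fun this f

theorem shift_zero (f : FreeGroup (ZMod 4)) : shift 0 f = f := by
  have : shift 0 = MonoidHom.id _ := by
    ext i
    simp
  exact DFunLike.congr_fun this f

/-- The action of `ℤ/4` on the free group, `k` sending `x i` to `x (i - k)`. -/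
def shiftAction : Multiplicative (ZMod 4) →* MulAut (FreeGroup (ZMod 4)) where
  toFun k :=
    -- The sign is forced: `inr k` acts by `f ↦ k f k⁻¹`, whereas `t⁻¹ (x i) t` is what raises the
    -- index.
    { toFun := shift (-k.toAdd)
      invFun := shift k.toAdd
      left_inv := fun f => by simp [shift_shift, shift_zero]
      right_inv := fun f => by simp [shift_shift, shift_zero]
      map_mul' := map_mul _ }
  map_one' := by
    ext f
    simp [shift_zero]
  map_mul' k l := by
    ext f
    simp [shift_shift]

theorem shiftAction_apply (k : Multiplicative (ZMod 4)) (f : FreeGroup (ZMod 4)) :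
    shiftAction k f = shift (-k.toAdd) f := rfl

/-- The homomorphism from the example group to the semidirect product of the free group and
`ℤ/4`. -/
noncomputable def toSemidirect : ExampleGroup →* FreeGroup (ZMod 4) ⋊[shiftAction] Multiplicative (ZMod 4) :=
  homOfRelations (fun i => SemidirectProduct.inl (FreeGroup.of i))
    (SemidirectProduct.inr (Multiplicative.ofAdd 1))
    (by
      rw [← map_pow, ← ofAdd_nsmul]
      exact map_one SemidirectProduct.inr)
    (fun i => by
      rw [← map_inv, ← SemidirectProduct.inl_aut_inv, ← map_inv, shiftAction_apply]
      simp)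

/-- The homomorphism from the free group to the example group. -/
def fromFree : FreeGroup (ZMod 4) →* ExampleGroup := FreeGroup.lift x

@[simp]
theorem fromFree_of (i : ZMod 4) : fromFree (FreeGroup.of i) = x i := by
  simp [fromFree]

theorem toSemidirect_fromFree (f : FreeGroup (ZMod 4)) :
    toSemidirect (fromFree f) = SemidirectProduct.inl f := by
  have : toSemidirect.comp fromFree = SemidirectProduct.inl := by
    ext1 i
    simp [toSemidirect]
  exact DFunLike.congr_fun this f

theorem fromFree_injective : Function.Injective fromFree := fun f g h =>
  SemidirectProduct.inl_injective (φ := shiftAction)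
    (by rw [← toSemidirect_fromFree, h, toSemidirect_fromFree])

/-- The exponent of `t` modulo `4`. -/
noncomputable def tExponent : ExampleGroup →* Multiplicative (ZMod 4) :=
  homOfRelations (fun _ => 1) (Multiplicative.ofAdd 1) (by decide) (fun _ => by simp)

theorem tExponent_t_pow (k : ℕ) : tExponent (t ^ k) = Multiplicative.ofAdd (k : ZMod 4) := by
  rw [map_pow, tExponent, homOfRelations_t, ← ofAdd_nsmul, nsmul_one]

theorem tExponent_of_mem {h : ExampleGroup} (hh : h ∈ H₁) : tExponent h = 1 := by
  have : H₁ ≤ tExponent.ker := by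
    rw [H₁, Subgroup.closure_le]
    rintro _ (rfl | rfl)
    exacts [homOfRelations_x _ _ _ _ 1, homOfRelations_x _ _ _ _ 2]
  exact this hh

theorem t_pow_eq_of_natCast_eq {k l : ℕ} (h : (k : ZMod 4) = l) : t ^ k = t ^ l :=
  pow_eq_pow_of_modEq ((ZMod.natCast_eq_natCast_iff _ _ _).1 h) t_pow_four

/-- The sum of the exponents of the generators `x i`. -/
noncomputable def xExponent : ExampleGroup →* Multiplicative ℤ :=
  homOfRelations (fun _ => Multiplicative.ofAdd 1) 1 (by simp) (fun _ => by simp)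

/-- The powers of `x i` are told apart by `xExponent`. -/
theorem infinite_of_x_mem {K : Subgroup ExampleGroup} {i : ZMod 4} (h : x i ∈ K) :
    (K : Set ExampleGroup).Infinite := by
  refine Set.infinite_of_injective_forall_mem (f := fun n : ℕ => x i ^ n) ?_
    (fun n => pow_mem h n)
  intro m n hmn
  have := congrArg xExponent hmn
  simpa [xExponent, ← ofAdd_nsmul] using this

theorem fromFree_mul_t_pow (f : FreeGroup (ZMod 4)) (k : ℕ) :
    fromFree f * t ^ k = t ^ k * fromFree (shift k f) := by
  have h1 (f : FreeGroup (ZMod 4)) : t⁻¹ * fromFree f * t = fromFree (shift 1 f) := by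
    have : (MulAut.conj t⁻¹).toMonoidHom.comp fromFree = fromFree.comp (shift 1) := by
      ext i
      simp [t_inv_mul_x_mul_t]
    simpa using DFunLike.congr_fun this f
  induction k with
  | zero => simp [shift_zero]
  | succ k ih =>
    rw [pow_succ, ← mul_assoc, ih, Nat.cast_succ, ← shift_shift, ← h1]
    group

theorem exists_eq_t_pow_mul_fromFree (g : ExampleGroup) :
    ∃ (k : ℕ) (f : FreeGroup (ZMod 4)), g = t ^ k * fromFree f := by
  have hg : g ∈ Subgroup.closure (Set.range (PresentedGroup.of (rels := relators))) := by
    rw [PresentedGroup.closure_range_of]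
    trivial
  -- This keeps the exponents of `t` natural numbers.
  have hinv : t⁻¹ = t ^ 3 := inv_eq_of_mul_eq_one_right (by rw [← pow_succ', t_pow_four])
  induction hg using Subgroup.closure_induction_right with
  | one => exact ⟨0, 1, by simp⟩
  | mul_right g _ y hy ih =>
    obtain ⟨k, f, rfl⟩ := ih
    obtain ⟨i | _, rfl⟩ := hy
    · exact ⟨k, f * FreeGroup.of i, by rw [map_mul, fromFree_of, mul_assoc]; rfl⟩
    · refine ⟨k + 1, shift (1 : ℕ) f, ?_⟩
      rw [pow_add, mul_assoc, mul_assoc, ← fromFree_mul_t_pow, pow_one]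
      rfl
  | mul_inv_cancel g _ y hy ih =>
    obtain ⟨k, f, rfl⟩ := ih
    obtain ⟨i | _, rfl⟩ := hy
    · exact ⟨k, f * (FreeGroup.of i)⁻¹, by rw [map_mul, map_inv, fromFree_of, mul_assoc]; rfl⟩
    · refine ⟨k + 3, shift (3 : ℕ) f, ?_⟩
      rw [pow_add, mul_assoc, mul_assoc, ← fromFree_mul_t_pow, ← hinv]
      rfl

/-! ### Conjugates of `H₁` with nontrivial intersection -/

theorem H₁_eq_map :
    H₁ = (Subgroup.closure (FreeGroup.of '' ({1, 2} : Set (ZMod 4)))).map fromFree := by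
  rw [MonoidHom.map_closure, Set.image_image, Set.image_pair, fromFree_of, fromFree_of]
  rfl

theorem x_one_mem : x 1 ∈ H₁ := Subgroup.subset_closure (Or.inl rfl)

theorem x_two_mem : x 2 ∈ H₁ := Subgroup.subset_closure (Or.inr rfl)

theorem map_shift_closure (A : Set (ZMod 4)) (k : ZMod 4) :
    (Subgroup.closure (FreeGroup.of '' A)).map (shift k) =
      Subgroup.closure (FreeGroup.of '' ((· + k) '' A)) := by
  rw [MonoidHom.map_closure, Set.image_image, Set.image_image]
  simp

/-- If `H₁` meets its conjugate by `g` nontrivially, `g` lies in one of the double cosets of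
`1`, `t` and `t⁻¹`. -/
theorem exists_eq_mul_t_pow_mul {g h : ExampleGroup} (h1 : h ≠ 1) (hh : h ∈ H₁)
    (hg : h ∈ conjugate H₁ g) :
    ∃ k : ℕ, (k : ZMod 4) ≠ 2 ∧ ∃ a ∈ H₁, ∃ b ∈ H₁, g = a * t ^ k * b := by
  obtain ⟨k, f, rfl⟩ := exists_eq_t_pow_mul_fromFree g
  rw [mem_conjugate] at hg
  rw [H₁_eq_map] at hh hg
  obtain ⟨a, ha, rfl⟩ := hh
  obtain ⟨b, hb, hab⟩ := hg
  have hconj : shift k b * f = f * a := by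
    apply fromFree_injective
    rw [map_mul, map_mul]
    apply mul_left_cancel (a := t ^ k)
    rw [← mul_assoc, ← fromFree_mul_t_pow, hab]
    group
  have hb' : shift k b ∈ Subgroup.closure (FreeGroup.of '' ((· + (k : ZMod 4)) '' {1, 2})) :=
    map_shift_closure _ _ ▸ Subgroup.mem_map_of_mem _ hb
  have hb1 : shift k b ≠ 1 := by
    intro hb1
    rw [hb1, one_mul, left_eq_mul] at hconj
    exact h1 (by rw [hconj, map_one])
  refine ⟨k, ?_, ?_⟩
  -- Translation by 2 takes `{1, 2}` to `{3, 0}`, which is disjoint from it.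
  · intro hk
    obtain ⟨i, hi, j, hj, hij⟩ := FreeGroup.inter_nonempty_of_mul_eq_mul ha hb' hb1 hconj
    rw [hk] at hij
    simp only [Set.mem_insert_iff, Set.mem_singleton_iff] at hi hj
    revert i j
    decide
  · obtain ⟨v, hv, w, hw, rfl⟩ := FreeGroup.exists_eq_mul_of_mul_eq_mul f ha hb' hb1 hconj
    rw [← map_shift_closure] at hv
    obtain ⟨v, hv, rfl⟩ := hv
    rw [H₁_eq_map]
    exact ⟨_, Subgroup.mem_map_of_mem _ hv, _, Subgroup.mem_map_of_mem _ hw, by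
      rw [fromFree_mul_t_pow, map_mul, mul_assoc]⟩

theorem tExponent_mul_t_pow_mul {a b : ExampleGroup} (ha : a ∈ H₁) (hb : b ∈ H₁) (k : ℕ) :
    tExponent (a * t ^ k * b) = Multiplicative.ofAdd (k : ZMod 4) := by
  rw [map_mul, map_mul, tExponent_of_mem ha, tExponent_of_mem hb, tExponent_t_pow, one_mul,
    mul_one]

theorem exists_ne_one_of_infinite {K : Subgroup ExampleGroup}
    (h : (K : Set ExampleGroup).Infinite) : ∃ y ∈ K, y ≠ 1 := by
  obtain ⟨y, hy, hy1⟩ := h.exists_notMem_finite (Set.finite_singleton 1)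
  exact ⟨y, hy, hy1⟩

theorem infinite_H₁ : (H₁ : Set ExampleGroup).Infinite := infinite_of_x_mem x_one_mem

theorem x_two_mem_conjugate_t : x 2 ∈ conjugate H₁ t := by
  rw [mem_conjugate, show (2 : ZMod 4) = 1 + 1 by decide, ← t_inv_mul_x_mul_t]
  simpa [mul_assoc] using x_one_mem

theorem x_one_mem_conjugate_t_pow_three : x 1 ∈ conjugate H₁ (t ^ 3) := by
  have h : x 2 * t ^ 3 = t ^ 3 * x 1 := by
    simpa [show (2 : ZMod 4) + 3 = 1 by decide] using fromFree_mul_t_pow (FreeGroup.of 2) 3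
  rw [mem_conjugate, ← h, mul_inv_cancel_right]
  exact x_two_mem

theorem t_pow_notMem {k : ℕ} (hk : (k : ZMod 4) ≠ 0) : t ^ k ∉ H₁ := fun h =>
  hk (by simpa [tExponent_t_pow] using tExponent_of_mem h)

/-! ### Bounds and witnesses for the three invariants -/

theorem heightWitness_two : HeightWitness H₁ 2 := by
  refine ⟨![1, t], essentiallyDistinct_of_mul_inv_notMem ?_, ?_⟩
  · have h : t ∉ H₁ := by simpa using t_pow_notMem (k := 1) (by decide)
    intro i j hij
    fin_cases i <;> fin_cases j <;> simp_all
  · refine infinite_of_x_mem (i := 2) ?_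
    rw [Subgroup.mem_iInf]
    intro i
    fin_cases i
    · simpa [conjugate_one] using x_two_mem
    · exact x_two_mem_conjugate_t

theorem WidthWitness.le_two {n : ℕ} (h : WidthWitness H₁ n) : n ≤ 2 := by
  obtain ⟨g, hg, hinf⟩ := h
  have key (i j : Fin n) (hij : i ≠ j) :
      (tExponent (g i)).toAdd - (tExponent (g j)).toAdd = 1 ∨
        (tExponent (g i)).toAdd - (tExponent (g j)).toAdd = 3 := by
    obtain ⟨y, ⟨hyi, hyj⟩, hy1⟩ := exists_ne_one_of_infinite (hinf i j hij)
    have hyi : y ∈ conjugate H₁ (g i) := hyi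
    have hyj : y ∈ conjugate H₁ (g j) := hyj
    rw [mem_conjugate] at hyi hyj
    -- Conjugation by `g j` carries the two conjugates to `H₁` and its conjugate by `g i * (g j)⁻¹`.
    obtain ⟨k, hk, a, ha, b, hb, hab⟩ := exists_eq_mul_t_pow_mul (g := g i * (g j)⁻¹)
      (by simpa [mul_inv_eq_one] using hy1) hyj
      (mem_conjugate.2 (by simpa [mul_assoc] using hyi))
    have hk0 : (k : ZMod 4) ≠ 0 := by
      intro hk0
      apply hg.mul_inv_notMem hij
      rw [hab, t_pow_eq_of_natCast_eq (l := 0) (by simpa using hk0), pow_zero, mul_one]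
      exact mul_mem ha hb
    have hd := congrArg tExponent hab
    rw [tExponent_mul_t_pow_mul ha hb, map_mul, map_inv, ← div_eq_mul_inv] at hd
    have hd : (tExponent (g i)).toAdd - (tExponent (g j)).toAdd = k := hd
    rw [hd]
    generalize (k : ZMod 4) = c at hk hk0
    revert c
    decide
  -- Three residues modulo 4 cannot pairwise differ by odd amounts, as two share a parity.
  by_contra! hn
  have h01 := key ⟨0, by omega⟩ ⟨1, by omega⟩ (by simp)
  have h02 := key ⟨0, by omega⟩ ⟨2, by omega⟩ (by simp)
  have h12 := key ⟨1, by omega⟩ ⟨2, by omega⟩ (by simp)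
  generalize (tExponent (g ⟨0, by omega⟩)).toAdd = a at h01 h02
  generalize (tExponent (g ⟨1, by omega⟩)).toAdd = b at h01 h12
  generalize (tExponent (g ⟨2, by omega⟩)).toAdd = c at h02 h12
  revert a b c
  decide

theorem weakWidthWitness_three : WeakWidthWitness H₁ 3 := by
  refine ⟨2, rfl, ![1, t, t ^ 3], rfl, ?_, ?_⟩
  · intro i j hij h
    obtain ⟨a, ha, b, hb, hab⟩ := DoubleCoset.mem_doubleCoset.1
      (h ▸ DoubleCoset.mem_doubleCoset_self _ _ _)
    have he := congrArg tExponent hab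
    rw [map_mul, map_mul, tExponent_of_mem ha, tExponent_of_mem hb, one_mul, mul_one] at he
    have h1 : tExponent t = Multiplicative.ofAdd 1 := by simpa using tExponent_t_pow 1
    fin_cases i <;> fin_cases j <;> simp [h1] at hij he <;> revert he <;> decide
  · intro i hi
    fin_cases i
    · simp at hi
    · exact infinite_of_x_mem (i := 2) ⟨x_two_mem, x_two_mem_conjugate_t⟩
    · exact infinite_of_x_mem (i := 1) ⟨x_one_mem, x_one_mem_conjugate_t_pow_three⟩

theorem WeakWidthWitness.le_three {n : ℕ} (h : WeakWidthWitness H₁ n) : n ≤ 3 := by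
  obtain ⟨m, rfl, g, h0, hg, hinf⟩ := h
  have key (i : Fin (m + 1)) :
      ∃ k : ℕ, (k : ZMod 4) ≠ 2 ∧ ∃ a ∈ H₁, ∃ b ∈ H₁, g i = a * t ^ k * b := by
    by_cases hi : i = 0
    · exact ⟨0, by decide, 1, one_mem _, 1, one_mem _, by simp [hi, h0]⟩
    · obtain ⟨y, ⟨hy, hyi⟩, hy1⟩ := exists_ne_one_of_infinite (hinf i hi)
      exact exists_eq_mul_t_pow_mul hy1 hy hyi
  choose k hk a ha b hb hab using key
  have hcoset (i) : DoubleCoset.doubleCoset (g i) (H₁ : Set ExampleGroup) H₁ =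
      DoubleCoset.doubleCoset (t ^ k i) H₁ H₁ :=
    DoubleCoset.doubleCoset_eq_of_mem
      (DoubleCoset.mem_doubleCoset.2 ⟨a i, ha i, b i, hb i, hab i⟩)
  have hinj : Function.Injective fun i => (k i : ZMod 4) := by
    intro i j hij
    by_contra hne
    exact hg i j hne (by rw [hcoset, hcoset, t_pow_eq_of_natCast_eq hij])
  -- Distinct double cosets have distinct exponents in `ZMod 4`, and 2 is excluded.
  have hcard := Finset.card_le_card_of_injOn (s := Finset.univ) (t := {2}ᶜ)
    (fun i => (k i : ZMod 4)) (fun i _ => by simpa using hk i) hinj.injOn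
  rwa [Finset.card_univ, Fintype.card_fin, show ({2}ᶜ : Finset (ZMod 4)).card = 3 by decide]
    at hcard

theorem height_H₁ : height H₁ = 2 := by
  rw [height, if_pos infinite_H₁]
  exact le_antisymm
    (iSup₂_le fun n hn => by exact_mod_cast WidthWitness.le_two (HeightWitness.widthWitness hn))
    (le_iSup₂_of_le 2 heightWitness_two le_rfl)

theorem width_H₁ : width H₁ = 2 := by
  rw [width, if_pos infinite_H₁]
  exact le_antisymm
    (iSup₂_le fun n hn => by exact_mod_cast WidthWitness.le_two hn)
    (le_iSup₂_of_le 2 heightWitness_two.widthWitness le_rfl)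

theorem weakWidth_H₁ : weakWidth H₁ = 3 := by
  rw [weakWidth, if_pos infinite_H₁]
  exact le_antisymm
    (iSup₂_le fun n hn => by exact_mod_cast WeakWidthWitness.le_three hn)
    (le_iSup₂_of_le 3 weakWidthWitness_three le_rfl)

end WidthExample

theorem mainTheorem2 :
    SubgroupWidth.weakWidth WidthExample.H₁ = 3 ∧
      SubgroupWidth.height WidthExample.H₁ = 2 ∧
      SubgroupWidth.width WidthExample.H₁ = 2 ∧
      SubgroupWidth.weakWidth WidthExample.H₁ ≠ SubgroupWidth.height WidthExample.H₁ ∧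
      SubgroupWidth.weakWidth WidthExample.H₁ ≠ SubgroupWidth.width WidthExample.H₁ := by
  rw [WidthExample.weakWidth_H₁, WidthExample.height_H₁, WidthExample.width_H₁]
  exact ⟨rfl, rfl, rfl, by decide, by decide⟩
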